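/- Let $K$ be an infinite field of characteristic different from $2$ and $3$. Let $A$ be a commutative, not necessarily associative or finite-dimensional, $K$-algebra, and let $\omega\colon A\to K$ be a nonzero algebra homomorphism with $(x^2)^2=\omega(x)^2x^2$ for all $x\in A$; that is, $(A,\omega)$ is a Bernstein algebra. Let $e$ be a nonzero idempotent of $A$, put $U=\{u\in A : eu=\tfrac12u\}$ and $V=\{v\in A : ev=0\}$, so that $A=Ke\oplus U\oplus V$ and $N:=\ker\omega=U\oplus V$. Assume that $A$ is Artinian, i.e. every descending sequence of ideals of $A$ is stationary. Then the following conditions are equivalent: (i) the ideal $N=U\oplus V$ is a nilpotent algebra; (ii) the associative algebra $\mathcal M_*^N(V)$ is nilpotent, where $\mathcal M_*^N(V)$ is the (non-unital) subalgebra of $\mathrm{End}_K(N)$ generated by the multiplication operators $L_v\colon N\to N$, $x\mapsto vx$, with $v\in V$; (iii) $I=0$ is the only subspace $I$ of $A$ such that $VI=I$, where $VI$ is the subspace spanned by all products $vx$ with $v\in V$, $x\in I$. Here an algebra $B$ is nilpotent if $B^n=0$ for some $n\ge1$, where $B^1=B$ and $B^i=\sum_{r+s=i,\;r,s\ge1}B^rB^s$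 for $i\ge2$. -/

import Mathlib

namespace Bernstein

section Algebras

variable (K : Type*) [Field K]
variable (B : Type*) [NonUnitalNonAssocRing B] [Module K B]
  [IsScalarTower K B B] [SMulCommClass K B B]

/-- The product `P Q` of two subspaces of a (not necessarily associative) `K`-algebra: the
subspace spanned by all products `p * q` with `p ∈ P` and `q ∈ Q`. -/
def subspaceMul {K : Type*} [Field K] {B : Type*} [NonUnitalNonAssocRing B] [Module K B]
    [IsScalarTower K B B] [SMulCommClass K B B] (P Q : Submodule K B) : Submodule K B :=
  Submodule.map₂ (LinearMap.mul K B) P Q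

/-- The powers of a (not necessarily associative) algebra `B`: `B^1 = B` and
`B^i = ∑_{r+s=i, r,s ≥ 1} B^r B^s` for `i ≥ 2`. (The value at `0` is a convention and is
not used.) -/
def algPow : ℕ → Submodule K B
  | 0 => ⊤
  | 1 => ⊤
  | n + 2 => ⨆ i : Fin (n + 1),
      subspaceMul (algPow (i.val + 1)) (algPow (n + 1 - i.val))
termination_by n => n
decreasing_by
  · have := i.isLt; omega
  · omega

/-- An algebra `B` is nilpotent if `B^n = 0` for some `n ≥ 1`. -/
def IsNilpotentAlg : Prop :=
  ∃ n : ℕ, 1 ≤ n ∧ algPow K B n = ⊥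

/-- A subspace is an ideal of the algebra if it absorbs multiplication on both sides. -/
def IsAlgIdeal {K : Type*} [Field K] {B : Type*} [NonUnitalNonAssocRing B] [Module K B]
    (I : Submodule K B) : Prop :=
  ∀ a : B, ∀ x ∈ I, a * x ∈ I ∧ x * a ∈ I

/-- An algebra is Artinian if every descending sequence of ideals is stationary. -/
def IsArtinianAlg (K : Type*) [Field K] (B : Type*) [NonUnitalNonAssocRing B] [Module K B] :
    Prop :=
  ∀ I : ℕ → Submodule K B, (∀ n, IsAlgIdeal (I n)) → Antitone I →
    ∃ n, ∀ m, n ≤ m → I m = I n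

/-- For a subset `S` of an algebra `B`, the (non-unital, associative) subalgebra `M_*^B(S)` of
`End_K(B)` generated by the multiplication operators `L_s : x ↦ s * x`, `s ∈ S`. -/
def multAlg {B : Type*} [NonUnitalNonAssocRing B] [Module K B]
    [IsScalarTower K B B] [SMulCommClass K B B] (S : Set B) :
    NonUnitalSubalgebra K (Module.End K B) :=
  NonUnitalAlgebra.adjoin K ((fun s : B => LinearMap.mulLeft K s) '' S)

end Algebras

section Bernstein

variable {K : Type*} [Field K]
variable {A : Type*} [NonUnitalNonAssocCommRing A] [Module K A]
  [IsScalarTower K A A] [SMulCommClass K A A]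

/-- The commutative algebra `A` is a Bernstein algebra with weight function `ω`: `ω` is a nonzero
algebra homomorphism to the ground field and `(x²)² = ω(x)² x²` holds identically. -/
structure IsBernstein (ω : A →ₙₐ[K] K) : Prop where
  ne_zero : ω ≠ 0
  identity : ∀ x : A, (x * x) * (x * x) = (ω x) ^ 2 • (x * x)

/-- The barideal `N = ker ω`, as an algebra. -/
def barideal (ω : A →ₙₐ[K] K) : NonUnitalSubalgebra K A where
  carrier := {x | ω x = 0}
  zero_mem' := map_zero ω
  add_mem' := by
    intro a b ha hb
    change ω a = 0 at ha
    change ω b = 0 at hb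
    change ω (a + b) = 0
    rw [map_add, ha, hb, add_zero]
  mul_mem' := by
    intro a b ha hb
    change ω a = 0 at ha
    change ω (a * b) = 0
    rw [map_mul, ha, zero_mul]
  smul_mem' := by
    intro c x hx
    change ω x = 0 at hx
    change ω (c • x) = 0
    rw [map_smul, hx, smul_zero]

/-- The Peirce component `V = {v ∈ A | e v = 0}`. -/
def peirceV (K : Type*) [Field K] {A : Type*} [NonUnitalNonAssocCommRing A] [Module K A]
    [IsScalarTower K A A] [SMulCommClass K A A] (e : A) : Submodule K A :=
  LinearMap.ker (LinearMap.mulLeft K e)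

/-- The Peirce component `U = {u ∈ A | e u = (1/2) u}`. -/
def peirceU (K : Type*) [Field K] {A : Type*} [NonUnitalNonAssocCommRing A] [Module K A]
    [IsScalarTower K A A] [SMulCommClass K A A] (e : A) : Submodule K A :=
  LinearMap.ker (LinearMap.mulLeft K e - (1 / 2 : K) • LinearMap.id)

theorem weight_idempotent {ω : A →ₙₐ[K] K} (hA : IsBernstein ω) {e : A} (he : e * e = e)
    (he0 : e ≠ 0) : ω e = 1 := by
  have h1 : ω e * ω e = ω e := by rw [← map_mul, he]
  have h0 : ω e * (ω e - 1) = 0 := by linear_combination h1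
  rcases mul_eq_zero.mp h0 with h | h
  · have h2 := hA.identity e
    rw [he, he, h] at h2
    exact absurd (by simpa using h2) he0
  · exact sub_eq_zero.mp h

theorem peirce_aux {ω : A →ₙₐ[K] K} (hA : IsBernstein ω) {e : A} (he : e * e = e)
    (hω : ω e = 1) (h2 : (2 : K) ≠ 0) {x : A} (hx : ω x = 0) :
    (2 : K) • (e * (e * x)) + (2 : K) • ((e * x) * (x * x)) = e * x := by
  have h4 : (4 : K) ≠ 0 := by
    have : (4 : K) = 2 * 2 := by norm_num
    rw [this]
    exact mul_ne_zero h2 h2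
  have hp := hA.identity (e + x)
  have hm := hA.identity (e + (-1 : K) • x)
  simp only [map_add, map_smul, hω, hx, smul_zero, add_zero, one_pow, one_smul, add_mul, mul_add,
    mul_smul_comm, smul_mul_assoc, he, mul_comm x e, mul_comm (e * x) e, mul_comm (x * x) e,
    mul_comm (x * x) (e * x), smul_add] at hp hm
  have key : (4 : K) • ((2 : K) • (e * (e * x)) + (2 : K) • ((e * x) * (x * x)))
      = (4 : K) • (e * x) := by
    linear_combination (norm := module) hp - hm
  exact smul_right_injective A h4 key

/-- In a Bernstein algebra over a field of characteristic different from 2 and 3, the barideal is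
the direct sum `N = U ⊕ V` of the Peirce components of any nonzero idempotent. -/
theorem barideal_eq_peirce {ω : A →ₙₐ[K] K} (hA : IsBernstein ω) {e : A} (he : e * e = e)
    (he0 : e ≠ 0) (h2 : (2 : K) ≠ 0) (h3 : (3 : K) ≠ 0) :
    (barideal ω).toSubmodule = peirceU K e ⊔ peirceV K e ∧
      Disjoint (peirceU K e) (peirceV K e) := by
  have hω := weight_idempotent hA he he0
  have memU : ∀ u : A, u ∈ peirceU K e ↔ e * u = (1 / 2 : K) • u := by
    intro u
    simp [peirceU, sub_eq_zero]
  have memV : ∀ v : A, v ∈ peirceV K e ↔ e * v = 0 := by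
    intro v
    simp [peirceV]
  have memN : ∀ x : A, x ∈ (barideal ω).toSubmodule ↔ ω x = 0 := fun x => Iff.rfl
  refine ⟨le_antisymm ?_ (sup_le ?_ ?_), ?_⟩
  · intro x hx
    rw [memN] at hx
    have a1 := peirce_aux hA he hω h2 hx
    have a2 := peirce_aux hA he hω h2 (x := (2 : K) • x) (by rw [map_smul, hx, smul_zero])
    simp only [mul_smul_comm, smul_mul_assoc] at a2
    have h12 : (12 : K) ≠ 0 := by
      have : (12 : K) = 2 * 2 * 3 := by norm_num
      rw [this]
      exact mul_ne_zero (mul_ne_zero h2 h2) h3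
    have a3 : (12 : K) • (e * (e * x)) = (12 : K) • ((1 / 2 : K) • (e * x)) := by
      rw [smul_smul, show (12 : K) * (1 / 2) = 6 by field_simp; norm_num]
      linear_combination (norm := module) (8 : K) • a1 - a2
    have a4 := smul_right_injective A h12 a3
    refine Submodule.mem_sup.mpr ⟨(2 : K) • (e * x), ?_, x - (2 : K) • (e * x), ?_, ?_⟩
    · rw [memU, mul_smul_comm, a4, smul_comm]
    · rw [memV, mul_sub, mul_smul_comm, a4, smul_smul, mul_one_div_cancel h2, one_smul, sub_self]
    · abel
  · intro u hu
    rw [memU] at hu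
    rw [memN]
    have h := congrArg ω hu
    rw [map_mul, hω, one_mul, map_smul, smul_eq_mul] at h
    have : (2 : K) * ω u = ω u := by
      conv_lhs => rw [h]
      field_simp
    linear_combination this
  · intro v hv
    rw [memV] at hv
    rw [memN]
    have h := congrArg ω hv
    simpa [hω] using h
  · rw [Submodule.disjoint_def]
    intro x hu hv
    rw [memU] at hu
    rw [memV] at hv
    rw [hv] at hu
    rcases smul_eq_zero.mp hu.symm with h | h
    · exact absurd h (by simpa using h2)
    · exact h

end Bernstein

end Bernstein

/-! Write L for `selfAnn U` and G_k = L + V^k U, where V^k U is the k-fold left product `leftPow V U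
k`. The Bernstein identity gives VL ⊆ L, VV ⊆ L, and that multiplications by elements of V
anticommute on U modulo L. It follows that G_k + U G_k is an ideal. Since U G_k ⊆ V, stationarity of
such ideals passes to their U-parts.

For (iii) ⇒ (i), the chain condition yields V^m L = 0 and then G_k = L for some k. It remains to
push the left powers N(N(⋯N)) down through the layers. On G_k / G_{k+1} the operators x ↦ (xy)c with
y, c ∈ U commute and square to zero (`mul_mul_comm`, `mul_mul_sq`). A minimal nonzero subspace of
this quotient reproduced by all of them together would be reproduced by a single one, which is
absurd (`le_layer_succ`). So iterating Y ↦ U(UY) + G_{k+1} ends at G_{k+1}, and some left power of N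
lies in G_{k+1} + U G_{k+1}. At the last layer UL = 0, so further factors act through V alone and
V^m L = 0 finishes.

The implications (i) ⇒ (ii) ⇒ (iii) need no chain condition: (ii) says that V^n N = 0 for some n. -/

namespace Bernstein

/-! ### Products of subspaces and iterated left products -/

section SubspaceProducts

variable {K : Type*} [Field K] {A : Type*} [NonUnitalNonAssocCommRing A] [Module K A]
  [IsScalarTower K A A] [SMulCommClass K A A]

theorem subspaceMul_le {P Q R : Submodule K A} :
    subspaceMul P Q ≤ R ↔ ∀ p ∈ P, ∀ q ∈ Q, p * q ∈ R := by
  simp [subspaceMul, Submodule.map₂_le]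

theorem mul_mem_subspaceMul {P Q : Submodule K A} {p q : A} (hp : p ∈ P) (hq : q ∈ Q) :
    p * q ∈ subspaceMul P Q :=
  subspaceMul_le.mp le_rfl p hp q hq

theorem subspaceMul_mono {P P' Q Q' : Submodule K A} (hP : P ≤ P') (hQ : Q ≤ Q') :
    subspaceMul P Q ≤ subspaceMul P' Q' :=
  Submodule.map₂_le_map₂ hP hQ

theorem subspaceMul_sup_right (P Q R : Submodule K A) :
    subspaceMul P (Q ⊔ R) = subspaceMul P Q ⊔ subspaceMul P R :=
  Submodule.map₂_sup_right _ _ _ _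

theorem subspaceMul_sup_left (P Q R : Submodule K A) :
    subspaceMul (P ⊔ Q) R = subspaceMul P R ⊔ subspaceMul Q R :=
  Submodule.map₂_sup_left _ _ _ _

theorem subspaceMul_bot (P : Submodule K A) : subspaceMul P ⊥ = ⊥ :=
  Submodule.map₂_bot_right _ _

/-- The iterated product `P (P (⋯ (P X)))` with `n` factors `P`. -/
def leftPow (P X : Submodule K A) : ℕ → Submodule K A
  | 0 => X
  | n + 1 => subspaceMul P (leftPow P X n)

theorem leftPow_antitone {P X : Submodule K A} (h : subspaceMul P X ≤ X) :
    Antitone (leftPow P X) := by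
  refine antitone_nat_of_succ_le fun n => ?_
  induction n with
  | zero => exact h
  | succ n ih => exact subspaceMul_mono le_rfl ih

theorem leftPow_add (P X : Submodule K A) (m n : ℕ) :
    leftPow P X (m + n) = leftPow P (leftPow P X m) n := by
  induction n with
  | zero => rfl
  | succ n ih => exact congrArg (subspaceMul P) ih

theorem leftPow_sup (P X Y : Submodule K A) (n : ℕ) :
    leftPow P (X ⊔ Y) n = leftPow P X n ⊔ leftPow P Y n := by
  induction n with
  | zero => rfl
  | succ n ih => simp only [leftPow, ih, subspaceMul_sup_right]

theorem le_leftPow {P X Y : Submodule K A} (h : X ≤ subspaceMul P X) (hX : X ≤ Y) (n : ℕ) :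
    X ≤ leftPow P Y n := by
  induction n with
  | zero => exact hX
  | succ n ih => exact h.trans (subspaceMul_mono le_rfl ih)

end SubspaceProducts

/-! ### Peirce relations from the Bernstein identity -/

section Peirce

variable {K : Type*} [Field K] {A : Type*} [NonUnitalNonAssocCommRing A] [Module K A]
  [IsScalarTower K A A] [SMulCommClass K A A]

/-- The relations between the Peirce components of a Bernstein algebra. -/
structure IsPeirce (e : A) (U V : Submodule K A) : Prop where
  decomp : ∀ a : A, ∃ c : K, ∃ u ∈ U, ∃ v ∈ V, a = c • e + u + v
  disj : Disjoint U V
  e_mul_U : ∀ u ∈ U, e * u = (1 / 2 : K) • u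
  e_mul_V : ∀ v ∈ V, e * v = 0
  UU : ∀ a ∈ U, ∀ b ∈ U, a * b ∈ V
  VU : ∀ v ∈ V, ∀ a ∈ U, v * a ∈ U
  VV : ∀ v ∈ V, ∀ w ∈ V, v * w ∈ U
  U_VV : ∀ a ∈ U, ∀ v ∈ V, ∀ w ∈ V, a * (v * w) = 0
  skew : ∀ a ∈ U, ∀ b ∈ U, ∀ v ∈ V, a * (v * b) + b * (v * a) = 0
  cyclic : ∀ a ∈ U, ∀ b ∈ U, ∀ c ∈ U, a * (b * c) + b * (c * a) + c * (a * b) = 0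
  anticomm : ∀ a ∈ U, ∀ b ∈ U, ∀ v ∈ V, ∀ w ∈ V, a * (v * (w * b) + w * (v * b)) = 0

theorem mem_peirceU {e u : A} : u ∈ peirceU K e ↔ e * u = (1 / 2 : K) • u := by
  simp [peirceU, sub_eq_zero]

theorem mem_peirceV {e v : A} : v ∈ peirceV K e ↔ e * v = 0 := by
  simp [peirceV]

theorem mem_barideal {ω : A →ₙₐ[K] K} {x : A} : x ∈ (barideal ω).toSubmodule ↔ ω x = 0 :=
  Iff.rfl

/-- This is the part even in x of the identity at e + x, isolated by adding the case of e - x; the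
quartic term vanishes because ω x = 0. -/
theorem sq_peirce_aux {ω : A →ₙₐ[K] K} (hA : IsBernstein ω) {e : A} (he : e * e = e)
    (hω : ω e = 1) (h2 : (2 : K) ≠ 0) {x : A} (hx : ω x = 0) :
    (2 : K) • (e * (x * x)) + (4 : K) • ((e * x) * (e * x)) = x * x := by
  have hp := hA.identity (e + x)
  have hm := hA.identity (e + (-1 : K) • x)
  have h0 := hA.identity x
  simp only [map_add, map_smul, hω, hx, smul_zero, add_zero, one_pow, one_smul, add_mul, mul_add,
    mul_smul_comm, smul_mul_assoc, he, mul_comm x e, mul_comm (e * x) e, mul_comm (x * x) e,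
    mul_comm (x * x) (e * x), smul_add] at hp hm
  simp only [hx, zero_pow two_ne_zero, zero_smul] at h0
  have key : (2 : K) • ((2 : K) • (e * (x * x)) + (4 : K) • ((e * x) * (e * x)))
      = (2 : K) • (x * x) := by
    linear_combination (norm := module) hp + hm - (2 : K) • h0
  exact smul_right_injective A h2 key

theorem eq_zero_of_two_smul (h2 : (2 : K) ≠ 0) {x : A} (h : (2 : K) • x = 0) : x = 0 :=
  (smul_eq_zero.mp h).resolve_left h2

theorem isPeirce {ω : A →ₙₐ[K] K} (hA : IsBernstein ω) {e : A} (he : e * e = e)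
    (he0 : e ≠ 0) (h2 : (2 : K) ≠ 0) (h3 : (3 : K) ≠ 0) :
    IsPeirce e (peirceU K e) (peirceV K e) := by
  have hω := weight_idempotent hA he he0
  obtain ⟨hN, hdisj⟩ := barideal_eq_peirce hA he he0 h2 h3
  have hU : ∀ u ∈ peirceU K e, ω u = 0 := fun u hu =>
    mem_barideal.mp (hN ▸ Submodule.mem_sup_left hu)
  have hV : ∀ u ∈ peirceV K e, ω u = 0 := fun u hu =>
    mem_barideal.mp (hN ▸ Submodule.mem_sup_right hu)
  have hhalf : (2 : K) * (1 / 2) = 1 := mul_one_div_cancel h2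
  have two {x : A} (h : (2 : K) • x = 0) : x = 0 := eq_zero_of_two_smul h2 h
  -- squares
  have sqU : ∀ u ∈ peirceU K e, e * (u * u) = 0 := by
    intro u hu
    have h := sq_peirce_aux hA he hω h2 (hU u hu)
    simp only [mem_peirceU.mp hu, smul_mul_assoc, mul_smul_comm, smul_smul] at h
    rw [show (4 : K) * (1 / 2 * (1 / 2)) = 1 by linear_combination (2 * (1 / 2) + 1) * hhalf,
      one_smul] at h
    exact two (by linear_combination (norm := module) h)
  have sqV : ∀ v ∈ peirceV K e, (2 : K) • (e * (v * v)) = v * v := by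
    intro v hv
    have h := sq_peirce_aux hA he hω h2 (hV v hv)
    simpa only [mem_peirceV.mp hv, mul_zero, smul_zero, add_zero] using h
  have memU' : ∀ u : A, (2 : K) • (e * u) = u → u ∈ peirceU K e := by
    intro u h
    rw [mem_peirceU]
    refine smul_right_injective A h2 ?_
    simp only [smul_smul, hhalf, one_smul, h]
  have UU : ∀ a ∈ peirceU K e, ∀ b ∈ peirceU K e, a * b ∈ peirceV K e := by
    intro a ha b hb
    rw [mem_peirceV]
    have h := sqU (a + b) (add_mem ha hb)
    simp only [add_mul, mul_add, sqU a ha, sqU b hb, mul_comm b a] at h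
    exact two (by linear_combination (norm := module) h)
  have VU : ∀ v ∈ peirceV K e, ∀ a ∈ peirceU K e, v * a ∈ peirceU K e := by
    intro v hv a ha
    apply memU'
    have h := sq_peirce_aux hA he hω h2 (x := v + a) (by rw [map_add, hV v hv, hU a ha, add_zero])
    have h' := sq_peirce_aux hA he hω h2 (hU a ha)
    have h'' := sqV v hv
    simp only [mul_add, add_mul, mem_peirceV.mp hv, zero_add, mul_comm a v, smul_add] at h h'
    refine smul_right_injective A h2 ?_
    linear_combination (norm := module) h - h' - h''
  have VV : ∀ v ∈ peirceV K e, ∀ w ∈ peirceV K e, v * w ∈ peirceU K e := by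
    intro v hv w hw
    apply memU'
    have h := sqV (v + w) (add_mem hv hw)
    simp only [mul_add, add_mul, mul_comm w v, smul_add] at h
    refine smul_right_injective A h2 ?_
    linear_combination (norm := module) h - sqV v hv - sqV w hw
  -- cubic identities
  have cube : ∀ a ∈ peirceU K e, ∀ v ∈ peirceV K e, a * ((a + v) * (a + v)) = 0 := by
    intro a ha v hv
    -- Here ex = a/2 and 2e(ex) = a/2, so the linear terms cancel and ax² = 0 remains.
    have h := peirce_aux hA he hω h2 (x := a + v) (by rw [map_add, hV v hv, hU a ha, add_zero])
    rw [show e * (a + v) = (1 / 2 : K) • a by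
      rw [mul_add, mem_peirceU.mp ha, mem_peirceV.mp hv, add_zero]] at h
    simp only [smul_mul_assoc, mul_smul_comm, mem_peirceU.mp ha, smul_smul, ← mul_assoc, hhalf,
      one_mul, one_smul] at h
    simpa using h
  have cubeU : ∀ a ∈ peirceU K e, a * (a * a) = 0 := by
    intro a ha
    simpa using cube a ha 0 (zero_mem _)
  have quad : ∀ a ∈ peirceU K e, ∀ v ∈ peirceV K e, a * (v * a) = 0 ∧ a * (v * v) = 0 := by
    intro a ha v hv
    have hp := cube a ha v hv
    have hm := cube a ha ((-1 : K) • v) (Submodule.smul_mem _ _ hv)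
    simp only [mul_add, add_mul, cubeU a ha, smul_mul_assoc, mul_smul_comm, mul_comm a v]
      at hp hm
    constructor
    · exact two (two (by linear_combination (norm := module) hp - hm))
    · exact two (by linear_combination (norm := module) hp + hm)
  have U_VV : ∀ a ∈ peirceU K e, ∀ v ∈ peirceV K e, ∀ w ∈ peirceV K e, a * (v * w) = 0 := by
    intro a ha v hv w hw
    have h := (quad a ha (v + w) (add_mem hv hw)).2
    simp only [mul_add, add_mul, (quad a ha v hv).2, (quad a ha w hw).2, mul_comm w v] at h
    exact two (by linear_combination (norm := module) h)
  have skew : ∀ a ∈ peirceU K e, ∀ b ∈ peirceU K e, ∀ v ∈ peirceV K e,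
      a * (v * b) + b * (v * a) = 0 := by
    intro a ha b hb v hv
    have h := (quad (a + b) (add_mem ha hb) v hv).1
    simp only [mul_add, add_mul, (quad a ha v hv).1, (quad b hb v hv).1] at h
    linear_combination (norm := module) h
  have cubeUU : ∀ a ∈ peirceU K e, ∀ b ∈ peirceU K e,
      a * (b * b) + (2 : K) • (b * (a * b)) = 0 := by
    intro a ha b hb
    have hp := cubeU (a + b) (add_mem ha hb)
    have hm := cubeU (a + (-1 : K) • b) (add_mem ha (Submodule.smul_mem _ _ hb))
    simp only [mul_add, add_mul, cubeU a ha, cubeU b hb, smul_mul_assoc, mul_smul_comm,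
      mul_comm b a] at hp hm
    exact two (by linear_combination (norm := module) hp + hm)
  have cyclic : ∀ a ∈ peirceU K e, ∀ b ∈ peirceU K e, ∀ c ∈ peirceU K e,
      a * (b * c) + b * (c * a) + c * (a * b) = 0 := by
    intro a ha b hb c hc
    have h := cubeUU a ha (b + c) (add_mem hb hc)
    have h1 := cubeUU a ha b hb
    have h2' := cubeUU a ha c hc
    simp only [mul_add, add_mul, smul_add, mul_comm c b] at h
    rw [mul_comm c a]
    exact two (by linear_combination (norm := module) h - h1 - h2')
  -- the quartic identity
  have quartic : ∀ v ∈ peirceV K e, ∀ a ∈ peirceU K e, (v * a) * (v * a) = 0 := by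
    intro v hv a ha
    have hp := hA.identity (a + v)
    have hm := hA.identity (a + (-1 : K) • v)
    have e1 : (a * a) * (v * v) = 0 := by
      have h := cubeUU (v * v) (VV v hv v hv) a ha
      rw [mul_comm (v * v) a, (quad a ha v hv).2, mul_zero, smul_zero, add_zero] at h
      rwa [mul_comm]
    have e2 : (v * a) * (v * v) = 0 := U_VV _ (VU v hv a ha) v hv v hv
    have e3 : (v * v) * (v * v) = 0 := U_VV _ (VV v hv v hv) v hv v hv
    have e4 : (a * a) * (a * a) = 0 := by
      have := hA.identity a
      rwa [hU a ha, zero_pow two_ne_zero, zero_smul] at this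
    simp only [map_add, map_smul, hU a ha, hV v hv, smul_zero, add_zero,
      zero_pow two_ne_zero, zero_smul, mul_add, add_mul, smul_mul_assoc, mul_smul_comm,
      mul_comm a v, mul_comm (v * v) (a * a), mul_comm (v * v) (v * a), mul_comm (v * a) (a * a),
      e1, e2, e3, e4] at hp hm
    -- The part even in v reduces to 8(va)² = 0, hence three divisions by 2.
    exact two (two (two (by linear_combination (norm := module) hp + hm)))
  have quartic' : ∀ v ∈ peirceV K e, ∀ a ∈ peirceU K e, ∀ b ∈ peirceU K e,
      (v * a) * (v * b) = 0 := by
    intro v hv a ha b hb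
    have h := quartic v hv (a + b) (add_mem ha hb)
    simp only [mul_add, add_mul, quartic v hv a ha, quartic v hv b hb,
      mul_comm (v * b) (v * a)] at h
    exact two (by linear_combination (norm := module) h)
  refine ⟨?_, hdisj, fun u hu => mem_peirceU.mp hu, fun v hv => mem_peirceV.mp hv, UU, VU, VV,
    U_VV, skew, cyclic, ?_⟩
  · intro a
    have ha : a - ω a • e ∈ (barideal ω).toSubmodule := by
      rw [mem_barideal, map_sub, map_smul, hω, smul_eq_mul, mul_one, sub_self]
    rw [hN] at ha
    obtain ⟨u, hu, v, hv, h⟩ := Submodule.mem_sup.mp ha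
    exact ⟨ω a, u, hu, v, hv, by rw [add_assoc, h]; abel⟩
  · intro a ha b hb v hv w hw
    -- Linearizing in v gives (va)(wb) + (wa)(vb) = 0; `skew` then moves v and w off a.
    have h := quartic' (v + w) (add_mem hv hw) a ha b hb
    have s1 := skew a ha (w * b) (VU w hw b hb) v hv
    have s2 := skew a ha (v * b) (VU v hv b hb) w hw
    simp only [mul_add, add_mul, quartic' v hv a ha b hb, quartic' w hw a ha b hb,
      mul_comm (w * b), mul_comm (v * b)] at h s1 s2 ⊢
    linear_combination (norm := module) s1 + s2 - h

end Peirce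

/-! ### Stable subspaces and the descending chain condition -/

section Chain

variable {K : Type*} [Field K] {A : Type*} [NonUnitalNonAssocCommRing A] [Module K A]
  [IsScalarTower K A A] [SMulCommClass K A A]

/-- The subspace of all elements of `U` that annihilate `U`. -/
def selfAnn (U : Submodule K A) : Submodule K A where
  carrier := {a | a ∈ U ∧ ∀ u ∈ U, a * u = 0}
  zero_mem' := ⟨zero_mem _, fun u _ => zero_mul u⟩
  add_mem' := fun ha hb => ⟨add_mem ha.1 hb.1, fun u hu => by
    rw [add_mul, ha.2 u hu, hb.2 u hu, add_zero]⟩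
  smul_mem' := fun c a ha => ⟨U.smul_mem c ha.1, fun u hu => by
    rw [smul_mul_assoc, ha.2 u hu, smul_zero]⟩

theorem selfAnn_le (U : Submodule K A) : selfAnn U ≤ U := fun _ h => h.1

theorem subspaceMul_selfAnn (U : Submodule K A) : subspaceMul U (selfAnn U) = ⊥ :=
  le_bot_iff.mp <| subspaceMul_le.mpr fun u hu a ha => by
    rw [mul_comm, ha.2 u hu]; exact zero_mem _

/-- The subspaces `X` of `U` for which `X ⊔ U X` is an ideal. -/
structure IsStable (U V X : Submodule K A) : Prop where
  le_U : X ≤ U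
  V_mul : subspaceMul V X ≤ X
  U_mul_U_mul : subspaceMul U (subspaceMul U X) ≤ X
  V_mul_U_mul : subspaceMul V (subspaceMul U X) ≤ X

theorem mul_mul_le_iff (P Q R : Submodule K A) :
    subspaceMul P (subspaceMul P Q) ≤ R ↔
      ∀ x ∈ Q, ∀ a ∈ P, ∀ c ∈ P, (x * a) * c ∈ R := by
  constructor
  · intro hle x hx a ha c hc
    rw [mul_comm, mul_comm x]
    exact hle (mul_mem_subspaceMul hc (mul_mem_subspaceMul ha hx))
  · intro hmem
    refine subspaceMul_le.mpr fun c hc z hz => ?_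
    suffices hle : subspaceMul P Q ≤ R.comap (LinearMap.mulLeft K c) from hle hz
    refine subspaceMul_le.mpr fun a ha x hx => ?_
    simp only [Submodule.mem_comap, LinearMap.mulLeft_apply]
    rw [mul_comm, mul_comm a]
    exact hmem x hx a ha c hc

theorem isStable_of_le_selfAnn {U V X : Submodule K A} (hX : X ≤ selfAnn U)
    (hV : subspaceMul V X ≤ X) : IsStable U V X := by
  have h0 : subspaceMul U X = ⊥ :=
    le_bot_iff.mp ((subspaceMul_mono le_rfl hX).trans (subspaceMul_selfAnn U).le)
  exact ⟨hX.trans (selfAnn_le U), hV, by rw [h0, subspaceMul_bot]; exact bot_le,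
    by rw [h0, subspaceMul_bot]; exact bot_le⟩

namespace IsPeirce

variable {e : A} {U V : Submodule K A}

theorem UU_le (h : IsPeirce e U V) {X : Submodule K A} (hX : X ≤ U) : subspaceMul U X ≤ V :=
  subspaceMul_le.mpr fun a ha b hb => h.UU a ha b (hX hb)

theorem V_mul_selfAnn (h : IsPeirce e U V) : subspaceMul V (selfAnn U) ≤ selfAnn U :=
  subspaceMul_le.mpr fun v hv a ha => ⟨h.VU v hv a ha.1, fun u hu => by
    have := h.skew u hu a ha.1 v hv
    rwa [ha.2 _ (h.VU v hv u hu), add_zero, mul_comm] at this⟩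

theorem VV_le_selfAnn (h : IsPeirce e U V) : subspaceMul V V ≤ selfAnn U :=
  subspaceMul_le.mpr fun v hv w hw => ⟨h.VV v hv w hw, fun u hu => by
    rw [mul_comm, h.U_VV u hu v hv w hw]⟩

theorem anticomm_mem (h : IsPeirce e U V) {v w b : A} (hv : v ∈ V) (hw : w ∈ V) (hb : b ∈ U) :
    v * (w * b) + w * (v * b) ∈ selfAnn U :=
  ⟨add_mem (h.VU v hv _ (h.VU w hw b hb)) (h.VU w hw _ (h.VU v hv b hb)), fun u hu => by
    rw [mul_comm, h.anticomm u hu b hb v hv w hw]⟩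

theorem isAlgIdeal (h : IsPeirce e U V) {X : Submodule K A} (hX : IsStable U V X) :
    IsAlgIdeal (X ⊔ subspaceMul U X) := by
  have key : ∀ a : A, ∀ x ∈ X ⊔ subspaceMul U X, a * x ∈ X ⊔ subspaceMul U X := by
    intro a y hy
    obtain ⟨x, hx, z, hz, rfl⟩ := Submodule.mem_sup.mp hy
    obtain ⟨c, u, hu, v, hv, rfl⟩ := h.decomp a
    have hex := h.e_mul_U x (hX.le_U hx)
    have hez := h.e_mul_V z (h.UU_le hX.le_U hz)
    have e1 : (c • e + u + v) * (x + z)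
        = (c • (1 / 2 : K) • x + u * z + v * x + v * z) + u * x := by
      simp only [add_mul, mul_add, smul_mul_assoc, hex, hez, smul_zero]
      abel
    rw [e1]
    refine add_mem (Submodule.mem_sup_left (add_mem (add_mem (add_mem ?_ ?_) ?_) ?_))
      (Submodule.mem_sup_right (mul_mem_subspaceMul hu hx))
    · exact X.smul_mem _ (X.smul_mem _ hx)
    · exact hX.U_mul_U_mul (mul_mem_subspaceMul hu hz)
    · exact hX.V_mul (mul_mem_subspaceMul hv hx)
    · exact hX.V_mul_U_mul (mul_mem_subspaceMul hv hz)
  exact fun a x hx => ⟨key a x hx, by rw [mul_comm]; exact key a x hx⟩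

/-- Because UX ⊆ V, the subspace X is recovered as the U-component of the ideal X + UX. -/
theorem le_of_sup_le (h : IsPeirce e U V) {X Y : Submodule K A} (hX : X ≤ U) (hY : Y ≤ U)
    (hle : X ⊔ subspaceMul U X ≤ Y ⊔ subspaceMul U Y) : X ≤ Y := by
  intro x hx
  obtain ⟨y, hy, z, hz, hyz⟩ := Submodule.mem_sup.mp (hle (Submodule.mem_sup_left hx))
  have hzU : z ∈ U := by
    rw [← add_sub_cancel_left y z, hyz]
    exact sub_mem (hX hx) (hY hy)
  rw [Submodule.disjoint_def.mp h.disj z hzU (h.UU_le hY hz), add_zero] at hyz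
  exact hyz ▸ hy

theorem exists_stationary (h : IsPeirce e U V) (hArt : IsArtinianAlg K A)
    {X : ℕ → Submodule K A} (hX : ∀ n, IsStable U V (X n)) (anti : Antitone X) :
    ∃ n, ∀ m, n ≤ m → X m = X n := by
  obtain ⟨n, hn⟩ := hArt (fun n => X n ⊔ subspaceMul U (X n)) (fun n => h.isAlgIdeal (hX n))
    (fun m n hmn => sup_le_sup (anti hmn) (subspaceMul_mono le_rfl (anti hmn)))
  exact ⟨n, fun m hm => le_antisymm (anti hm)
    (h.le_of_sup_le (hX n).le_U (hX m).le_U (hn m hm).ge)⟩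

theorem exists_minimal (h : IsPeirce e U V) (hArt : IsArtinianAlg K A)
    {S : Set (Submodule K A)} (hS : ∀ X ∈ S, IsStable U V X) (hne : S.Nonempty) :
    ∃ X ∈ S, ∀ Y ∈ S, Y ≤ X → Y = X := by
  by_contra! hcon
  choose! f hfS hfle hfne using hcon
  obtain ⟨X₀, hX₀⟩ := hne
  have hmem : ∀ n, f^[n] X₀ ∈ S := by
    intro n
    induction n with
    | zero => exact hX₀
    | succ n ih => rw [Function.iterate_succ_apply' f]; exact hfS _ ih
  obtain ⟨n, hn⟩ := h.exists_stationary hArt (fun n => hS _ (hmem n))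
    (antitone_nat_of_succ_le fun n => by
      rw [Function.iterate_succ_apply' f]; exact hfle _ (hmem n))
  refine hfne _ (hmem n) ?_
  rw [← Function.iterate_succ_apply' f]
  exact hn (n + 1) n.le_succ

/-- U kills L, so every V^n L is itself an ideal; the stationary term is fixed by V and hence zero.
-/
theorem leftPow_selfAnn_eq_bot (h : IsPeirce e U V) (hArt : IsArtinianAlg K A)
    (hI : ∀ I : Submodule K A, subspaceMul V I = I → I = ⊥) :
    ∃ m, leftPow V (selfAnn U) m = ⊥ := by
  have anti := leftPow_antitone h.V_mul_selfAnn
  obtain ⟨n, hn⟩ := h.exists_stationary hArt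
    (fun n => isStable_of_le_selfAnn (anti n.zero_le) (anti n.le_succ)) anti
  exact ⟨n, hI _ (hn (n + 1) n.le_succ)⟩

/-! ### The layers L + V^k U -/

theorem V_mul_U_le (h : IsPeirce e U V) : subspaceMul V U ≤ U :=
  subspaceMul_le.mpr h.VU

theorem layer_le (h : IsPeirce e U V) (k : ℕ) : selfAnn U ⊔ leftPow V U k ≤ U :=
  sup_le (selfAnn_le U) (leftPow_antitone h.V_mul_U_le k.zero_le)

theorem V_mul_layer_le (h : IsPeirce e U V) (k : ℕ) :
    subspaceMul V (selfAnn U ⊔ leftPow V U k) ≤ selfAnn U ⊔ leftPow V U (k + 1) := by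
  rw [subspaceMul_sup_right]
  exact sup_le_sup h.V_mul_selfAnn le_rfl

theorem layer_succ_le (h : IsPeirce e U V) (k : ℕ) :
    selfAnn U ⊔ leftPow V U (k + 1) ≤ selfAnn U ⊔ leftPow V U k :=
  sup_le_sup le_rfl (leftPow_antitone h.V_mul_U_le k.le_succ)

/-- For x = vb, `skew` and `cyclic` turn ((vb)a)c into ((va)c)b + (bc)(va). The first term is in
V·V^k U; by anticommutation the second is -v((bc)a) modulo L, and (bc)a is in the k-th layer by
induction. -/
theorem mul_mul_mem_layer (h : IsPeirce e U V) (k : ℕ) :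
    ∀ x ∈ selfAnn U ⊔ leftPow V U k, ∀ a ∈ U, ∀ c ∈ U,
      (x * a) * c ∈ selfAnn U ⊔ leftPow V U k := by
  induction k with
  | zero =>
    intro x hx a ha c hc
    exact Submodule.mem_sup_right (h.VU _ (h.UU x (h.layer_le 0 hx) a ha) c hc)
  | succ k ih =>
    intro x hx a ha c hc
    suffices hle : selfAnn U ⊔ leftPow V U (k + 1) ≤
        (selfAnn U ⊔ leftPow V U (k + 1)).comap
          ((LinearMap.mulRight K c).comp (LinearMap.mulRight K a)) from hle hx
    refine sup_le (fun y hy => ?_) (subspaceMul_le.mpr fun v hv b hb => ?_)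
    · simp only [Submodule.mem_comap, LinearMap.comp_apply, LinearMap.mulRight_apply, hy.2 a ha,
        zero_mul, zero_mem]
    simp only [Submodule.mem_comap, LinearMap.comp_apply, LinearMap.mulRight_apply]
    have hbU : b ∈ U := leftPow_antitone h.V_mul_U_le k.zero_le hb
    have hvaU := h.VU v hv a ha
    have e1 := h.skew a ha b hbU v hv
    have e2 := h.cyclic b hbU (v * a) hvaU c hc
    have hbc := h.UU b hbU c hc
    have m1 : ((v * a) * c) * b ∈ leftPow V U (k + 1) :=
      mul_mem_subspaceMul (h.UU _ hvaU c hc) hb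
    have m2 := h.anticomm_mem hbc hv ha
    have m3 : v * ((b * c) * a) ∈ selfAnn U ⊔ leftPow V U (k + 1) :=
      h.V_mul_layer_le k (mul_mem_subspaceMul hv (ih b (Submodule.mem_sup_right hb) c hc a ha))
    have e3 : (v * b * a) * c
        = ((v * a) * c) * b + ((b * c) * (v * a) + v * ((b * c) * a)) - v * ((b * c) * a) := by
      rw [show v * b * a = - (b * (v * a)) by rw [mul_comm (v * b) a]; exact eq_neg_of_add_eq_zero_left e1]
      rw [mul_comm c b, mul_comm _ (b * c), mul_comm c (b * _), mul_comm b (v * a * c)] at e2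
      linear_combination (norm := skip) -e2
      simp only [neg_mul]
      abel
    rw [e3]
    exact sub_mem (add_mem (Submodule.mem_sup_right m1) (Submodule.mem_sup_left m2)) m3

/-- Between consecutive layers only U(UX) ⊆ X has to be checked: V lowers the layer, and V(UX) ⊆ VV
⊆ L. -/
theorem isStable_of_layer (h : IsPeirce e U V) {k : ℕ} {X : Submodule K A}
    (hG : selfAnn U ⊔ leftPow V U (k + 1) ≤ X) (hX : X ≤ selfAnn U ⊔ leftPow V U k)
    (hUU : subspaceMul U (subspaceMul U X) ≤ X) : IsStable U V X where
  le_U := hX.trans (h.layer_le k)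
  V_mul := (subspaceMul_mono le_rfl hX).trans ((h.V_mul_layer_le k).trans hG)
  U_mul_U_mul := hUU
  V_mul_U_mul := (subspaceMul_mono le_rfl (h.UU_le (hX.trans (h.layer_le k)))).trans
    (h.VV_le_selfAnn.trans (le_sup_left.trans hG))

theorem isStable_layer (h : IsPeirce e U V) (k : ℕ) :
    IsStable U V (selfAnn U ⊔ leftPow V U k) :=
  h.isStable_of_layer (h.layer_succ_le k) le_rfl
    ((mul_mul_le_iff _ _ _).mpr (h.mul_mul_mem_layer k))

theorem exists_layer_eq_selfAnn (h : IsPeirce e U V) (hArt : IsArtinianAlg K A)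
    (hI : ∀ I : Submodule K A, subspaceMul V I = I → I = ⊥) :
    ∃ k, selfAnn U ⊔ leftPow V U k = selfAnn U := by
  obtain ⟨m, hm⟩ := h.leftPow_selfAnn_eq_bot hArt hI
  obtain ⟨n, hn⟩ := h.exists_stationary hArt h.isStable_layer
    (antitone_nat_of_succ_le h.layer_succ_le)
  -- Applying V^m kills L and leaves V^(n+1+m) U = V^(n+m) U.
  have h1 := congrArg (fun X => leftPow V X m) (hn (n + 1) n.le_succ)
  simp only [leftPow_sup, hm, bot_sup_eq, ← leftPow_add] at h1
  have h2 : leftPow V U (n + m) = ⊥ := by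
    refine hI _ ?_
    rw [show n + 1 + m = n + m + 1 by omega] at h1
    exact h1
  exact ⟨n + m, by rw [h2, sup_bot_eq]⟩

/-! ### Skew-symmetry of repeated multiplication by U modulo the next layer -/

section Skew

variable {k : ℕ} {x y z c w : A}

/-- By `cyclic` the sum is -(yc)x, and yc ∈ V lowers the layer of x. -/
theorem mul_mul_skew (h : IsPeirce e U V) (hx : x ∈ selfAnn U ⊔ leftPow V U k) (hy : y ∈ U)
    (hc : c ∈ U) : (x * y) * c + (x * c) * y ∈ selfAnn U ⊔ leftPow V U (k + 1) := by
  have e1 := h.cyclic x (h.layer_le k hx) y hy c hc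
  have e2 : (x * y) * c + (x * c) * y = - ((y * c) * x) := by
    rw [mul_comm x (y * c), mul_comm c x, mul_comm y (x * c), mul_comm c (x * y)] at e1
    linear_combination (norm := abel) e1
  rw [e2]
  exact neg_mem (h.V_mul_layer_le k (mul_mem_subspaceMul (h.UU y hy c hc) hx))

/-- This is `skew` for the element xy of V, so no correction term appears. -/
theorem mul_skew (h : IsPeirce e U V) (hx : x ∈ U) (hy : y ∈ U) (hc : c ∈ U) (hz : z ∈ U) :
    ((x * y) * c) * z + ((x * y) * z) * c = 0 := by
  have := h.skew z hz c hc (x * y) (h.UU x hx y hy)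
  rwa [mul_comm z, mul_comm c] at this

/-- Swapping the first y and c produces ((xc)y)y, which vanishes by skew-symmetry. -/
theorem mul_mul_sq (h : IsPeirce e U V) (h2 : (2 : K) ≠ 0)
    (hx : x ∈ selfAnn U ⊔ leftPow V U k) (hy : y ∈ U) (hc : c ∈ U) :
    (((x * y) * c) * y) * c ∈ selfAnn U ⊔ leftPow V U (k + 1) := by
  have hxU := h.layer_le k hx
  have e0 : (((x * c) * y) * y) * c = 0 := by
    have := h.mul_skew hxU hc hy hy
    have : ((x * c) * y) * y = 0 := eq_zero_of_two_smul h2 (by rw [two_smul]; exact this)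
    rw [this, zero_mul]
  have := h.mul_mul_mem_layer (k + 1) _ (h.mul_mul_skew hx hy hc) y hy c hc
  simpa only [add_mul, e0, add_zero] using this

/-- Exchanging the pairs (y, c) and (z, w) takes four adjacent swaps, so the signs cancel. -/
theorem mul_mul_comm (h : IsPeirce e U V) (hx : x ∈ selfAnn U ⊔ leftPow V U k) (hy : y ∈ U)
    (hc : c ∈ U) (hz : z ∈ U) (hw : w ∈ U) :
    (((x * y) * c) * z) * w - (((x * z) * w) * y) * c ∈ selfAnn U ⊔ leftPow V U (k + 1) := by
  have hxU := h.layer_le k hx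
  have s1 : (((x * y) * c) * z) * w + (((x * y) * z) * c) * w = 0 := by
    rw [← add_mul, h.mul_skew hxU hy hc hz, zero_mul]
  have s2 := h.mul_mul_mem_layer (k + 1) _ (h.mul_mul_skew hx hy hz) c hc w hw
  have s3 := h.mul_mul_skew (h.mul_mul_mem_layer k x hx z hz y hy) hc hw
  have s4 : (((x * z) * y) * w) * c + (((x * z) * w) * y) * c = 0 := by
    rw [← add_mul, h.mul_skew hxU hz hy hw, zero_mul]
  have := sub_mem s3 s2
  simp only [add_mul] at this
  convert this using 1
  linear_combination (norm := abel) s1 - s4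

end Skew

/-! ### Descent from one layer to the next -/

/-- No subspace strictly above a layer reproduces itself under multiplication by `U` twice. -/
theorem le_layer_succ (h : IsPeirce e U V) (hArt : IsArtinianAlg K A) (h2 : (2 : K) ≠ 0) (k : ℕ)
    {E : Submodule K A} (hst : IsStable U V E) (hGE : selfAnn U ⊔ leftPow V U (k + 1) ≤ E)
    (hE : E ≤ selfAnn U ⊔ leftPow V U k)
    (hrep : E ≤ subspaceMul U (subspaceMul U E) ⊔ (selfAnn U ⊔ leftPow V U (k + 1))) :
    E ≤ selfAnn U ⊔ leftPow V U (k + 1) := by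
  by_contra hnot
  set G := selfAnn U ⊔ leftPow V U (k + 1) with hG
  obtain ⟨F, ⟨hF, hGF, hFX, hFrep, hFnot⟩, hmin⟩ := h.exists_minimal hArt
    (S := {E | IsStable U V E ∧ G ≤ E ∧ E ≤ selfAnn U ⊔ leftPow V U k ∧
      E ≤ subspaceMul U (subspaceMul U E) ⊔ G ∧ ¬ E ≤ G}) (fun X hX => hX.1)
    ⟨E, hst, hGE, hE, hrep, hnot⟩
  -- If every x ↦ (xy)c sent F into G, reproduction would force F ⊆ G.
  obtain ⟨y, hy, c, hc, hyc⟩ : ∃ y ∈ U, ∃ c ∈ U, ∃ x ∈ F, (x * y) * c ∉ G := by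
    by_contra! hcon
    exact hFnot (hFrep.trans (sup_le ((mul_mul_le_iff _ _ _).mpr
      fun x hx a ha c hc => hcon a ha c hc x hx) le_rfl))
  let t : A →ₗ[K] A := (LinearMap.mulRight K c).comp (LinearMap.mulRight K y)
  have ht : ∀ x, t x = (x * y) * c := fun x => rfl
  have htG : ∀ x ∈ G, t x ∈ G := fun x hx => h.mul_mul_mem_layer (k + 1) x hx y hy c hc
  let F' := F.map t ⊔ G
  have hF'F : F' ≤ F := by
    refine sup_le (Submodule.map_le_iff_le_comap.mpr fun x hx => ?_) hGF
    exact (mul_mul_le_iff _ _ _).mp hF.U_mul_U_mul x hx y hy c hc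
  -- Commutation modulo G lets F' = tF + G inherit stability and reproduction from F, so minimality
  -- gives F' = F.
  have comm : ∀ x ∈ F, ∀ z ∈ U, ∀ w ∈ U, t ((x * z) * w) - ((t x * z) * w) ∈ G :=
    fun x hx z hz w hw => h.mul_mul_comm (hFX hx) hz hw hy hc
  have hF'UU : subspaceMul U (subspaceMul U F') ≤ F' := by
    refine (mul_mul_le_iff _ _ _).mpr fun x' hx' z hz w hw => ?_
    obtain ⟨_, ⟨x, hx, rfl⟩, g, hg, rfl⟩ := Submodule.mem_sup.mp hx'
    have m1 : (g * z) * w ∈ G := h.mul_mul_mem_layer (k + 1) g hg z hz w hw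
    have m2 : t ((x * z) * w) ∈ F.map t :=
      Submodule.mem_map_of_mem ((mul_mul_le_iff _ _ _).mp hF.U_mul_U_mul x hx z hz w hw)
    have e1 : ((t x + g) * z) * w
        = t ((x * z) * w) + ((g * z) * w - (t ((x * z) * w) - ((t x * z) * w))) := by
      simp only [add_mul]; abel
    rw [e1]
    exact add_mem (Submodule.mem_sup_left m2)
      (Submodule.mem_sup_right (sub_mem m1 (comm x hx z hz w hw)))
  have hF'mem : F' = F := by
    refine hmin F' ⟨?_, le_sup_right, hF'F.trans hFX, ?_, ?_⟩ hF'F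
    · exact h.isStable_of_layer le_sup_right (hF'F.trans hFX) hF'UU
    · refine sup_le (Submodule.map_le_iff_le_comap.mpr (hFrep.trans (sup_le ?_ ?_))) le_sup_right
      · refine (mul_mul_le_iff _ _ _).mpr fun x hx z hz w hw => ?_
        have m1 : (t x * z) * w ∈ subspaceMul U (subspaceMul U F') :=
          (mul_mul_le_iff _ _ _).mp le_rfl (t x)
            (Submodule.mem_sup_left (Submodule.mem_map_of_mem hx)) z hz w hw
        rw [Submodule.mem_comap, ← sub_add_cancel (t (x * z * w)) (t x * z * w)]
        exact add_mem (Submodule.mem_sup_right (comm x hx z hz w hw)) (Submodule.mem_sup_left m1)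
      · exact fun g hg => Submodule.mem_sup_right (htG g hg)
    · obtain ⟨x, hx, hxG⟩ := hyc
      exact fun hle => hxG (hle (Submodule.mem_sup_left (Submodule.mem_map_of_mem hx)))
  obtain ⟨x, hx, hxG⟩ := hyc
  refine hxG ?_
  -- Now tF = tF' ⊆ t²F + tG ⊆ G, against the choice of t.
  suffices hle : F' ≤ G.comap t from hle (hF'mem.symm ▸ hx)
  refine sup_le (Submodule.map_le_iff_le_comap.mpr fun x hx => ?_) htG
  exact h.mul_mul_sq h2 (hFX hx) hy hc

/-- A step of the descent: with `N = U ⊔ V`, `N (N I)` goes from `I = Y + U Y` to the analogous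
sum for `U (U Y) + G`. -/
theorem descent_step {G Y : Submodule K A} (h : IsPeirce e U V) (hLG : selfAnn U ≤ G)
    (hY : Y ≤ U) (hVY : subspaceMul V Y ≤ G) (hGY : G ≤ Y)
    (hUU : subspaceMul U (subspaceMul U Y) ≤ Y) {n : ℕ}
    (hn : leftPow (U ⊔ V) (U ⊔ V) n ≤ Y ⊔ subspaceMul U Y) :
    leftPow (U ⊔ V) (U ⊔ V) (n + 2) ≤
      (subspaceMul U (subspaceMul U Y) ⊔ G) ⊔
        subspaceMul U (subspaceMul U (subspaceMul U Y) ⊔ G) := by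
  set Y' := subspaceMul U (subspaceMul U Y) ⊔ G with hY'
  have hVUY : subspaceMul V (subspaceMul U Y) ≤ Y' :=
    (subspaceMul_mono le_rfl (h.UU_le hY)).trans
      (h.VV_le_selfAnn.trans (hLG.trans le_sup_right))
  have hVY' : subspaceMul V Y' ≤ Y' :=
    (subspaceMul_mono le_rfl (sup_le hUU hGY)).trans (hVY.trans le_sup_right)
  -- One factor N replaces Y by Y' but still leaves UY; the second replaces UY by UY'.
  have step1 : leftPow (U ⊔ V) (U ⊔ V) (n + 1) ≤ Y' ⊔ subspaceMul U Y := by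
    refine (subspaceMul_mono le_rfl hn).trans ?_
    rw [subspaceMul_sup_left, subspaceMul_sup_right, subspaceMul_sup_right]
    exact sup_le (sup_le le_sup_right (le_sup_left.trans le_sup_left))
      (sup_le (hVY.trans (le_sup_right.trans le_sup_left)) (hVUY.trans le_sup_left))
  refine (subspaceMul_mono le_rfl step1).trans ?_
  rw [subspaceMul_sup_left, subspaceMul_sup_right U Y', subspaceMul_sup_right V Y']
  exact sup_le (sup_le le_sup_right (le_sup_left.trans le_sup_left))
      (sup_le (hVY'.trans le_sup_left) (hVUY.trans le_sup_left))

theorem exists_leftPow_le_layer (h : IsPeirce e U V) (hArt : IsArtinianAlg K A)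
    (h2 : (2 : K) ≠ 0) (k : ℕ) :
    ∃ n, leftPow (U ⊔ V) (U ⊔ V) n ≤
      (selfAnn U ⊔ leftPow V U k) ⊔ subspaceMul U (selfAnn U ⊔ leftPow V U k) := by
  induction k with
  | zero =>
    refine ⟨1, ?_⟩
    have hU : selfAnn U ⊔ leftPow V U 0 = U := sup_eq_right.mpr (selfAnn_le U)
    rw [hU]
    simp only [leftPow, subspaceMul_sup_left, subspaceMul_sup_right]
    refine sup_le (sup_le le_sup_right (le_sup_of_le_left h.V_mul_U_le)) (sup_le ?_ ?_)
    · refine le_sup_of_le_left (subspaceMul_le.mpr fun a ha v hv => ?_)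
      rw [mul_comm]
      exact h.VU v hv a ha
    · exact le_sup_of_le_left (subspaceMul_le.mpr h.VV)
  | succ k ih =>
    obtain ⟨n, hn⟩ := ih
    set G := selfAnn U ⊔ leftPow V U (k + 1) with hG
    let Y : ℕ → Submodule K A := fun i => Nat.rec (selfAnn U ⊔ leftPow V U k)
      (fun _ X => subspaceMul U (subspaceMul U X) ⊔ G) i
    have hY0 : Y 0 = selfAnn U ⊔ leftPow V U k := rfl
    have hYs : ∀ i, Y (i + 1) = subspaceMul U (subspaceMul U (Y i)) ⊔ G := fun i => rfl
    have hGY : ∀ i, G ≤ Y i := by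
      rintro (_ | i)
      · exact h.layer_succ_le k
      · exact le_sup_right
    have anti : Antitone Y := by
      refine antitone_nat_of_succ_le fun i => ?_
      induction i with
      | zero => exact sup_le (h.isStable_layer k).U_mul_U_mul (h.layer_succ_le k)
      | succ i ih =>
        exact sup_le_sup (subspaceMul_mono le_rfl (subspaceMul_mono le_rfl ih)) le_rfl
    have hUU : ∀ i, subspaceMul U (subspaceMul U (Y i)) ≤ Y i := fun i =>
      le_sup_left.trans (anti i.le_succ)
    have hYX : ∀ i, Y i ≤ selfAnn U ⊔ leftPow V U k := fun i => anti i.zero_le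
    have hst : ∀ i, IsStable U V (Y i) := fun i => h.isStable_of_layer (hGY i) (hYX i) (hUU i)
    obtain ⟨p, hp⟩ := h.exists_stationary hArt hst anti
    have hpG : Y p = G := le_antisymm
      (h.le_layer_succ hArt h2 k (hst p) (hGY p) (hYX p) (hp (p + 1) p.le_succ).ge) (hGY p)
    have hdesc : ∀ i, leftPow (U ⊔ V) (U ⊔ V) (n + 2 * i) ≤ Y i ⊔ subspaceMul U (Y i) := by
      intro i
      induction i with
      | zero => exact hn
      | succ i ih =>
        exact h.descent_step le_sup_left (hst i).le_U
          ((subspaceMul_mono le_rfl (hYX i)).trans (h.V_mul_layer_le k)) (hGY i) (hUU i) ih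
    exact ⟨n + 2 * p, hpG ▸ hdesc p⟩

theorem exists_leftPow_eq_bot (h : IsPeirce e U V) (hArt : IsArtinianAlg K A)
    (h2 : (2 : K) ≠ 0) (hI : ∀ I : Submodule K A, subspaceMul V I = I → I = ⊥) :
    ∃ n, leftPow (U ⊔ V) (U ⊔ V) n = ⊥ := by
  obtain ⟨m, hm⟩ := h.leftPow_selfAnn_eq_bot hArt hI
  obtain ⟨k, hk⟩ := h.exists_layer_eq_selfAnn hArt hI
  obtain ⟨n, hn⟩ := h.exists_leftPow_le_layer hArt h2 k
  rw [hk, subspaceMul_selfAnn, sup_bot_eq] at hn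
  -- Once inside L, the U-part of each further factor contributes nothing.
  have key : ∀ i, leftPow (U ⊔ V) (U ⊔ V) (n + i) ≤ leftPow V (selfAnn U) i := by
    intro i
    induction i with
    | zero => exact hn
    | succ i ih =>
      refine (subspaceMul_mono le_rfl ih).trans ?_
      rw [subspaceMul_sup_left]
      refine sup_le ?_ le_rfl
      refine (subspaceMul_mono le_rfl (leftPow_antitone h.V_mul_selfAnn i.zero_le)).trans ?_
      exact (subspaceMul_selfAnn U).le.trans bot_le
  exact ⟨n + m, le_bot_iff.mp ((key m).trans hm.le)⟩

end IsPeirce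

end Chain

/-! ### Nilpotency in terms of left powers -/

section Nilpotency

variable {K : Type*} [Field K] {A : Type*} [NonUnitalNonAssocCommRing A] [Module K A]
  [IsScalarTower K A A] [SMulCommClass K A A]

theorem algPow_add_two_le {B : Type*} [NonUnitalNonAssocRing B] [Module K B]
    [IsScalarTower K B B] [SMulCommClass K B B] {n : ℕ} {R : Submodule K B}
    (h : ∀ r s, 1 ≤ r → 1 ≤ s → r + s = n + 2 → ∀ p ∈ algPow K B r, ∀ q ∈ algPow K B s,
      p * q ∈ R) : algPow K B (n + 2) ≤ R := by
  rw [algPow]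
  refine iSup_le fun i => Submodule.map₂_le.mpr fun p hp q hq => ?_
  have := i.isLt
  exact h (i.val + 1) (n + 1 - i.val) (by omega) (by omega) (by omega) p hp q hq

theorem mul_mem_algPow {B : Type*} [NonUnitalNonAssocRing B] [Module K B]
    [IsScalarTower K B B] [SMulCommClass K B B] {n : ℕ} {p q : B}
    (hq : q ∈ algPow K B (n + 1)) : p * q ∈ algPow K B (n + 2) := by
  rw [algPow]
  refine Submodule.mem_iSup_of_mem (⟨0, n.succ_pos⟩ : Fin (n + 1)) ?_
  refine Submodule.apply_mem_map₂ (LinearMap.mul K B) ?_ hq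
  simp [algPow]

variable {ω : A →ₙₐ[K] K}

/-- In a product of total degree at least 2^(j+1) one factor has degree at least 2^j; commutativity
puts it on the right, so degree 2^j lies in the j-th left power. -/
theorem isNilpotentAlg_barideal {n : ℕ}
    (h : leftPow (barideal ω).toSubmodule (barideal ω).toSubmodule n = ⊥) :
    IsNilpotentAlg K (barideal ω) := by
  have key : ∀ j m, 2 ^ j ≤ m → ∀ x ∈ algPow K (barideal ω) m,
      (x : A) ∈ leftPow (barideal ω).toSubmodule (barideal ω).toSubmodule j := by
    intro j
    induction j with
    | zero => exact fun m _ x _ => x.2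
    | succ j ih =>
      intro m hm x hx
      have h1 : 1 ≤ 2 ^ j := Nat.one_le_two_pow
      rw [pow_succ] at hm
      obtain ⟨m, rfl⟩ : ∃ l, m = l + 2 := ⟨m - 2, by omega⟩
      refine algPow_add_two_le (R := (leftPow (barideal ω).toSubmodule
        (barideal ω).toSubmodule (j + 1)).comap (barideal ω).toSubmodule.subtype)
        (fun r s _ _ hrs p hp q hq => ?_) hx
      change (p : A) * (q : A) ∈ leftPow (barideal ω).toSubmodule (barideal ω).toSubmodule (j + 1)
      rcases le_total (2 ^ j) s with hs | hs
      · exact mul_mem_subspaceMul p.2 (ih s hs q hq)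
      · rw [mul_comm]
        exact mul_mem_subspaceMul q.2 (ih r (by omega) p hp)
  refine ⟨2 ^ n, Nat.one_le_two_pow, (Submodule.eq_bot_iff _).mpr fun x hx => ?_⟩
  have := key n _ le_rfl x hx
  rw [h] at this
  exact Subtype.ext this

theorem leftPow_le_algPow_barideal {V : Submodule K A} (hV : V ≤ (barideal ω).toSubmodule)
    (n : ℕ) : leftPow V (barideal ω).toSubmodule n ≤
      (algPow K (barideal ω) (n + 1)).map (barideal ω).toSubmodule.subtype := by
  induction n with
  | zero =>
    intro x hx
    exact ⟨⟨x, hx⟩, by simp [algPow], rfl⟩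
  | succ n ih =>
    refine subspaceMul_le.mpr fun v hv y hy => ?_
    obtain ⟨q, hq, rfl⟩ := ih hy
    exact ⟨(⟨v, hV hv⟩ : barideal ω) * (q : barideal ω), mul_mem_algPow (B := barideal ω) hq, rfl⟩

variable {V : Submodule K A}

theorem multAlg_apply_mem (hV : V ≤ (barideal ω).toSubmodule) {f : Module.End K (barideal ω)}
    (hf : f ∈ multAlg K {x : barideal ω | (x : A) ∈ V}) (k : ℕ) (x : barideal ω)
    (hx : (x : A) ∈ leftPow V (barideal ω).toSubmodule k) :
    (f x : A) ∈ leftPow V (barideal ω).toSubmodule (k + 1) := by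
  have hVN : subspaceMul V (barideal ω).toSubmodule ≤ (barideal ω).toSubmodule :=
    subspaceMul_le.mpr fun v hv y hy => (barideal ω).mul_mem (hV hv) hy
  induction hf using NonUnitalAlgebra.adjoin_induction generalizing k x with
  | mem f hf =>
    obtain ⟨s, hs, rfl⟩ := hf
    exact mul_mem_subspaceMul hs hx
  | add f g _ _ ihf ihg => exact add_mem (ihf k x hx) (ihg k x hx)
  | zero => exact zero_mem _
  | mul f g _ _ ihf ihg =>
    exact leftPow_antitone hVN (k + 1).le_succ (ihf _ _ (ihg k x hx))
  | smul c f _ ih => exact Submodule.smul_mem _ c (ih k x hx)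

theorem algPow_multAlg_apply_mem (hV : V ≤ (barideal ω).toSubmodule) (n : ℕ) (hn : 1 ≤ n) :
    ∀ f ∈ algPow K (multAlg K {x : barideal ω | (x : A) ∈ V}) n, ∀ k, ∀ x : barideal ω,
      (x : A) ∈ leftPow V (barideal ω).toSubmodule k →
      (f.1 x : A) ∈ leftPow V (barideal ω).toSubmodule (k + n) := by
  induction n using Nat.strong_induction_on with
  | _ n ih =>
    obtain _ | _ | n := n
    · omega
    · exact fun f _ k x hx => multAlg_apply_mem hV f.2 k x hx
    intro f hf k x hx
    let ev : multAlg K {x : barideal ω | (x : A) ∈ V} →ₗ[K] A :=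
      (barideal ω).toSubmodule.subtype.comp ((LinearMap.applyₗ x).comp
        (multAlg K {x : barideal ω | (x : A) ∈ V}).toSubmodule.subtype)
    refine algPow_add_two_le
      (R := (leftPow V (barideal ω).toSubmodule (k + (n + 2))).comap ev)
      (fun r s hr hs hrs p hp q hq => ?_) hf
    change (p.1 (q.1 x) : A) ∈ leftPow V (barideal ω).toSubmodule (k + (n + 2))
    have h1 := ih r (by omega) hr p hp _ _ (ih s (by omega) hs q hq k x hx)
    rwa [show k + s + r = k + (n + 2) by omega] at h1

/-- An n-fold product of operators raises the left-power index by at least n; conversely, V^n N is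
spanned by values of such products. -/
theorem isNilpotentAlg_multAlg_iff (hV : V ≤ (barideal ω).toSubmodule) :
    IsNilpotentAlg K (multAlg K {x : barideal ω | (x : A) ∈ V}) ↔
      ∃ n, leftPow V (barideal ω).toSubmodule n = ⊥ := by
  have hVN : subspaceMul V (barideal ω).toSubmodule ≤ (barideal ω).toSubmodule :=
    subspaceMul_le.mpr fun v hv y hy => (barideal ω).mul_mem (hV hv) hy
  constructor
  · rintro ⟨n, hn, h⟩
    obtain ⟨n, rfl⟩ : ∃ l, n = l + 1 := ⟨n - 1, by omega⟩
    have key : ∀ n, leftPow V (barideal ω).toSubmodule (n + 1) ≤ Submodule.span K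
        {y : A | ∃ f ∈ algPow K (multAlg K {x : barideal ω | (x : A) ∈ V}) (n + 1),
          ∃ x : barideal ω, y = f.1 x} := by
      intro n
      have gen : ∀ (v : A) (hv : v ∈ V), LinearMap.mulLeft K (⟨v, hV hv⟩ : barideal ω) ∈
          multAlg K {x : barideal ω | (x : A) ∈ V} := fun v hv =>
        NonUnitalAlgebra.subset_adjoin K ⟨⟨v, hV hv⟩, hv, rfl⟩
      induction n with
      | zero =>
        refine subspaceMul_le.mpr fun v hv y hy => Submodule.subset_span ?_
        exact ⟨⟨_, gen v hv⟩, by simp [algPow], ⟨y, hy⟩, rfl⟩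
      | succ n ih =>
        refine subspaceMul_le.mpr fun v hv y hy => ?_
        suffices hle : Submodule.span K _ ≤ (Submodule.span K _).comap (LinearMap.mulLeft K v) from
          hle (ih hy)
        refine Submodule.span_le.mpr ?_
        rintro _ ⟨f, hf, x, rfl⟩
        exact Submodule.subset_span ⟨⟨_, gen v hv⟩ * f, mul_mem_algPow hf, x, rfl⟩
    refine ⟨n + 1, le_bot_iff.mp ((key n).trans (Submodule.span_le.mpr ?_))⟩
    rintro _ ⟨f, hf, x, rfl⟩
    rw [h, Submodule.mem_bot] at hf
    simp [hf]
  · rintro ⟨n, hn⟩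
    refine ⟨n + 1, by omega, (Submodule.eq_bot_iff _).mpr fun f hf => ?_⟩
    refine Subtype.ext (LinearMap.ext fun x => Subtype.ext ?_)
    have h1 := algPow_multAlg_apply_mem hV (n + 1) (by omega) f hf 0 x x.2
    have h2 := leftPow_antitone hVN (show n ≤ 0 + (n + 1) by omega) h1
    rw [hn] at h2
    exact h2

end Nilpotency

end Bernstein

/-! ### The equivalence -/

theorem theorem5p2 {K : Type*} [Field K] [Infinite K] (h2 : (2 : K) ≠ 0) (h3 : (3 : K) ≠ 0)
    {A : Type*} [NonUnitalNonAssocCommRing A] [Module K A]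
    [IsScalarTower K A A] [SMulCommClass K A A]
    (ω : A →ₙₐ[K] K) (hA : Bernstein.IsBernstein ω) (hArt : Bernstein.IsArtinianAlg K A)
    (e : A) (he : e * e = e) (he0 : e ≠ 0) :
    List.TFAE [
      Bernstein.IsNilpotentAlg K (Bernstein.barideal ω),
      Bernstein.IsNilpotentAlg K
        (Bernstein.multAlg K {x : Bernstein.barideal ω | (x : A) ∈ Bernstein.peirceV K e}),
      ∀ I : Submodule K A, Bernstein.subspaceMul (Bernstein.peirceV K e) I = I ↔ I = ⊥] := by
  obtain ⟨hN, -⟩ := Bernstein.barideal_eq_peirce hA he he0 h2 h3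
  have hV : Bernstein.peirceV K e ≤ (Bernstein.barideal ω).toSubmodule := hN ▸ le_sup_right
  tfae_have 1 → 2 := by
    rintro ⟨n, hn, h⟩
    obtain ⟨n, rfl⟩ : ∃ l, n = l + 1 := ⟨n - 1, by omega⟩
    refine (Bernstein.isNilpotentAlg_multAlg_iff hV).mpr ⟨n, le_bot_iff.mp ?_⟩
    refine (Bernstein.leftPow_le_algPow_barideal hV n).trans ?_
    rw [h, Submodule.map_bot]
  tfae_have 2 → 3 := by
    intro h I
    obtain ⟨n, hn⟩ := (Bernstein.isNilpotentAlg_multAlg_iff hV).mp h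
    refine ⟨fun hI => ?_, fun hI => by rw [hI, Bernstein.subspaceMul_bot]⟩
    -- I = VI lies in N because ω vanishes on V, so iterating gives I ⊆ V^n N.
    have hIN : I ≤ (Bernstein.barideal ω).toSubmodule := by
      rw [← hI]
      refine Bernstein.subspaceMul_le.mpr fun v hv x _ => ?_
      rw [Bernstein.mem_barideal, map_mul, Bernstein.mem_barideal.mp (hV hv), zero_mul]
    exact le_bot_iff.mp ((Bernstein.le_leftPow hI.ge hIN n).trans hn.le)
  tfae_have 3 → 1 := by
    intro h
    obtain ⟨n, hn⟩ := (Bernstein.isPeirce hA he he0 h2 h3).exists_leftPow_eq_bot hArt h2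
      fun I hI => (h I).mp hI
    rw [← hN] at hn
    exact Bernstein.isNilpotentAlg_barideal hn
  tfae_finish
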